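/- Let $V$ be a finite set of qubits. A \emph{stabilizer-state graph} on $V$ is a simple graph on $V$ in which each node is either solid or hollow, may or may not carry a self loop, and may or may not carry a minus sign. (A looped node is not its own neighbor; nodes are labeled by the qubits.) It represents the quantum state (vectors being taken up to a global phase) obtained from $|0\rangle^{\otimes V}$ by applying the Hadamard gate $H=\tfrac{1}{\sqrt2}\begin{pmatrix}1&1\\1&-1\end{pmatrix}$ to every qubit, then a controlled-$Z$ gate for every edge, and then on each qubit, in this order, $Z$ if the node has a minus sign, $S=\mathrm{diag}(1,i)$ if it has a loop, and $H$ if it is hollow. Two graphs are \emph{equivalent} if they represent the same state. A graph is \emph{reduced} if no hollow node has a loop and no two hollow nodes are connected. \emph{Local complementation on a node} complements all edges between its neighbors; \emph{local complementation along an edge} $ab$ is local complementation on $a$, then $b$, then $a$. To \emph{advance} the loop of a node means to add a loop if there is none, and otherwise to remove the loop and flip the node's sign. Consider the following rules. E1. For a node with a loop: flip its fill, perform local complementation on it, advance the loops of its neighbors, and flip its sign; if it now has a minus sign, flip the signs of its neighbors. E2. For two connected nodes without loops: flip both fills, local complement along the edge between them, and flip the signs of the nodes that were connected to both; for each of the two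 nodes that had a minus sign in the original graph, flip its sign and the signs of its current neighbors. E(i). In a reduced graph, for a hollow node $h$ connected to a solid node $s$ with a loop: local complement on $s$ and then on $h$, remove the loop from $s$, advance the loops of the current neighbors of $s$, and flip the fills of $h$ and $s$. Flip the signs of the nodes that were originally connected to both $s$ and $h$; if $s$ initially had a minus sign, flip its sign and the signs of its current neighbors; if $h$ initially had a minus sign, flip the signs of its current neighbors. E(ii). In a reduced graph, for a hollow node connected to a solid node without a loop: local complement along the edge between them and flip both fills, with signs changed as in E2. Then: (1) E1 and E2 take any stabilizer-state graph to an equivalent one. (2) E(i) and E(ii) take any reduced graph to an equivalent reduced graph. (3) Two stabilizer-state graphs on $V$ are equivalent if and only if the first can be converted into the second by a finite sequence of applications of E1 and E2. (4) Two reduced graphs on $V$ are equivalent if and only if the first can be converted into the second by a finite sequence of applications of E(i) and E(ii). (5) A stabilizer-state graph is reduced if and only if no graph equivalent to it has fewer hollow nodes. -/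

import Mathlib

open Matrix
open scoped symmDiff

/-- A stabilizer-state graph with node (qubit) set `V`: a simple graph of edges, together with
the set of hollow nodes (all other nodes are solid), the set of nodes carrying a self loop, and
the set of nodes carrying a minus sign. -/
@[ext]
structure StabGraph (V : Type*) where
  edges : SimpleGraph V
  hollow : Set V
  loops : Set V
  minus : Set V

namespace StabGraph

variable {V : Type*}

/-! ### The state represented by a stabilizer graph -/

section State

/-- The Hadamard gate. -/
noncomputable def gateH : Matrix (Fin 2) (Fin 2) ℂ :=
  ((1 / Real.sqrt 2 : ℝ) : ℂ) • !![1, 1; 1, -1]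

/-- The phase gate. -/
def gateS : Matrix (Fin 2) (Fin 2) ℂ := !![1, 0; 0, Complex.I]

/-- The Pauli `Z` gate. -/
def gateZ : Matrix (Fin 2) (Fin 2) ℂ := !![1, 0; 0, -1]

variable [Fintype V]

/-- The operator `⨂_v U_v` on the qubits `V`, as a matrix in the standard basis, whose elements
are indexed by the bit strings `V → Fin 2`. -/
def tensorGate (U : V → Matrix (Fin 2) (Fin 2) ℂ) : Matrix (V → Fin 2) (V → Fin 2) ℂ :=
  Matrix.of fun x y => ∏ v, U v (x v) (y v)

variable [DecidableEq V]

/-- The standard basis state `|0…0⟩`. -/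
def ketZero : (V → Fin 2) → ℂ := Pi.single 0 1

open scoped Classical in
/-- The product of the (diagonal, hence commuting) controlled-`Z` gates over all edges: the
gate of the edge `e` multiplies `|x⟩` by `-1` when both end points of `e` have bit `1`. -/
noncomputable def czLayer (Γ : SimpleGraph V) : Matrix (V → Fin 2) (V → Fin 2) ℂ :=
  Matrix.diagonal fun x =>
    ∏ e : Sym2 V, if e ∈ Γ.edgeSet ∧ ∀ v ∈ e, x v = 1 then (-1 : ℂ) else 1

open scoped Classical in
/-- The terminal gates on qubit `v`: first `Z` if the node has a minus sign, then `S` if it has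
a loop, then `H` if it is hollow. -/
noncomputable def terminalGate (G : StabGraph V) (v : V) : Matrix (Fin 2) (Fin 2) ℂ :=
  (if v ∈ G.hollow then gateH else 1) * (if v ∈ G.loops then gateS else 1) *
    (if v ∈ G.minus then gateZ else 1)

/-- The output of the graph-form circuit of `G`: `H` on every qubit of `|0…0⟩`, then a
controlled-`Z` for each edge, then the terminal gates. -/
noncomputable def state (G : StabGraph V) : (V → Fin 2) → ℂ :=
  tensorGate G.terminalGate *ᵥ (czLayer G.edges *ᵥ (tensorGate (fun _ => gateH) *ᵥ ketZero))

/-- Two graphs are equivalent when they represent the same quantum state, that is, when their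
state vectors agree up to a global phase. -/
def Equivalent (G G' : StabGraph V) : Prop :=
  ∃ c : ℂ, ‖c‖ = 1 ∧ G'.state = c • G.state

end State

/-! ### Elementary operations on stabilizer graphs -/

/-- The neighbors of a node; a node is never its own neighbor, even if it has a loop. -/
def nbr (G : StabGraph V) (v : V) : Set V := G.edges.neighborSet v

/-- Flip the fills of the nodes in `A`. -/
def flipFill (G : StabGraph V) (A : Set V) : StabGraph V :=
  { G with hollow := G.hollow ∆ A }

/-- Flip the signs of the nodes in `A`. -/
def flipSign (G : StabGraph V) (A : Set V) : StabGraph V :=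
  { G with minus := G.minus ∆ A }

/-- Advance the loops of the nodes in `A`: a node of `A` without a loop acquires one; a node of
`A` with a loop loses it and has its sign flipped. -/
def advance (G : StabGraph V) (A : Set V) : StabGraph V :=
  { G with loops := G.loops ∆ A, minus := G.minus ∆ (G.loops ∩ A) }

/-- Remove the loop, if any, of the node `v`. -/
def removeLoop (G : StabGraph V) (v : V) : StabGraph V :=
  { G with loops := G.loops \ {v} }

/-- Local complementation on the node `v`: complement the edges between all neighbors of `v`. -/
def localComp (G : StabGraph V) (v : V) : StabGraph V :=
  { G with
    edges :=
      { Adj := fun x y => x ≠ y ∧ Xor (G.edges.Adj x y) (G.edges.Adj v x ∧ G.edges.Adj v y)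
        symm := ⟨fun x y h =>
          ⟨h.1.symm, by simpa only [G.edges.adj_comm y x, and_comm] using h.2⟩⟩
        loopless := ⟨fun _ h => h.1 rfl⟩ } }

/-- Local complementation along the edge between `a` and `b`. -/
def localCompEdge (G : StabGraph V) (a b : V) : StabGraph V :=
  ((G.localComp a).localComp b).localComp a

/-- A graph is reduced if hollow nodes have no loops and are not connected to each other. -/
def IsReduced (G : StabGraph V) : Prop :=
  (∀ v ∈ G.hollow, v ∉ G.loops) ∧ ∀ a ∈ G.hollow, ∀ b ∈ G.hollow, ¬ G.edges.Adj a b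

/-! ### The equivalence rules -/

open scoped Classical in
/-- Rule E1 on the node `v` (to be used when `v` has a loop): flip the fill of `v`, perform local
complementation on `v`, advance the loops of its neighbors and flip the sign of `v`; if `v` now
has a minus sign, flip the signs of its neighbors. -/
noncomputable def ruleE1 (G : StabGraph V) (v : V) : StabGraph V :=
  let G₁ := (((G.flipFill {v}).localComp v).advance (G.nbr v)).flipSign {v}
  if v ∈ G₁.minus then G₁.flipSign (G₁.nbr v) else G₁

open scoped Classical in
/-- Rule E2 on the nodes `a`, `b` (to be used when they are connected and have no loops): flip
the fills of both, local complement along the edge between them and flip the signs of the nodes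
that were connected to both; for each of `a`, `b` that had a minus sign in the original graph,
flip its sign and the signs of its current neighbors. -/
noncomputable def ruleE2 (G : StabGraph V) (a b : V) : StabGraph V :=
  let G₁ := ((G.flipFill {a, b}).localCompEdge a b).flipSign (G.nbr a ∩ G.nbr b)
  let G₂ := if a ∈ G.minus then G₁.flipSign ({a} ∪ G₁.nbr a) else G₁
  if b ∈ G.minus then G₂.flipSign ({b} ∪ G₂.nbr b) else G₂

open scoped Classical in
/-- Rule E(i) on a hollow node `h` connected to a solid node `s` with a loop: local complement on
`s` and then on `h`, remove the loop of `s`, advance the loops of the current neighbors of `s`,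
and flip the fills of both. Signs: flip the signs of the nodes originally connected to both `s`
and `h`; if `s` initially had a minus sign, flip its sign and those of its current neighbors; if
`h` initially had a minus sign, flip the signs of its current neighbors. -/
noncomputable def ruleEi (G : StabGraph V) (h s : V) : StabGraph V :=
  let G₁ := ((G.localComp s).localComp h).removeLoop s
  let G₂ := ((G₁.advance (G₁.nbr s)).flipFill {h, s}).flipSign (G.nbr s ∩ G.nbr h)
  let G₃ := if s ∈ G.minus then G₂.flipSign ({s} ∪ G₂.nbr s) else G₂
  if h ∈ G.minus then G₃.flipSign (G₃.nbr h) else G₃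

open scoped Classical in
/-- Rule E(ii) on a hollow node `h` connected to a solid node `s` without a loop: local
complement along the edge between them and flip the fills of both, with signs as in E2. -/
noncomputable def ruleEii (G : StabGraph V) (h s : V) : StabGraph V :=
  let G₁ := ((G.localCompEdge h s).flipFill {h, s}).flipSign (G.nbr h ∩ G.nbr s)
  let G₂ := if h ∈ G.minus then G₁.flipSign ({h} ∪ G₁.nbr h) else G₁
  if s ∈ G.minus then G₂.flipSign ({s} ∪ G₂.nbr s) else G₂

/-- `G'` results from `G` by one application of E1 or E2. -/
inductive Step : StabGraph V → StabGraph V → Prop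
  | e1 (G : StabGraph V) (v : V) (hv : v ∈ G.loops) : Step G (G.ruleE1 v)
  | e2 (G : StabGraph V) (a b : V) (hab : G.edges.Adj a b) (ha : a ∉ G.loops)
      (hb : b ∉ G.loops) : Step G (G.ruleE2 a b)

/-- `G'` results from the reduced graph `G` by one application of E(i) or E(ii). -/
inductive ReducedStep : StabGraph V → StabGraph V → Prop
  | ei (G : StabGraph V) (hG : G.IsReduced) (h s : V) (hh : h ∈ G.hollow) (hs : s ∉ G.hollow)
      (hhs : G.edges.Adj h s) (hl : s ∈ G.loops) : ReducedStep G (G.ruleEi h s)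
  | eii (G : StabGraph V) (hG : G.IsReduced) (h s : V) (hh : h ∈ G.hollow) (hs : s ∉ G.hollow)
      (hhs : G.edges.Adj h s) (hl : s ∉ G.loops) : ReducedStep G (G.ruleEii h s)

end StabGraph

/-!
Up to a scalar, the state of a graph is a layer of Hadamard gates, on the hollow nodes, applied to
the quadratic phase function that is `1` at `0` and gains the factor `w u * ∏_{v ~ u} (-1)^{x v}`
when the bit `u` is set; here `w u ∈ {±1, ±i}` encodes the loop and the sign of `u`. A phase
function is determined by these factors. A Hadamard gate on a node `v` with `w v ^ 2 = -1`
multiplies it by `1 + z`, where `z = w v * (±1)`, and `1 - z = -z * (1 + z)` shows that the result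
is the phase function of the local complement. Similarly, Hadamard gates on two adjacent nodes with
weights `±1` multiply it by `1 + α + β - α * β`, where `α` and `β` are signs, and lead to the pivot.

Conversely, a graph is determined by its state and its hollow nodes. While a graph is not reduced,
E1 or E2 removes hollow nodes. In a reduced graph a hollow node `h` imposes the linear constraint
`w h * (-1)^{x h} * ∏_{v ~ h} (-1)^{x v} = 1` on the support of the state, whereas the support of a
state takes all values on the solid nodes of any of its graphs. Hence if a hollow node of one
reduced graph is solid in an equivalent one, it has a neighbor that is hollow there, and E(i) or
E(ii) exchanges the two, as in the basis exchange of a matroid. So reduced graphs are connected by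
E(i) and E(ii), which are combinations of E1 and E2 that preserve the number of hollow nodes.
-/

namespace StabGraph

variable {V : Type*}

/-! ### Characters of bit strings -/

section SetSign

variable [Fintype V]

open scoped Classical in
/-- The character `x ↦ ∏_{w ∈ S} (-1)^{x w}` of the group of bit strings given by a set of
nodes `S`. -/
noncomputable def setSign (S : Set V) (x : V → Fin 2) : ℂ :=
  ∏ w, if w ∈ S ∧ x w = 1 then -1 else 1

lemma setSign_congr {S T : Set V} {x y : V → Fin 2}
    (h : ∀ w, (w ∈ S ∧ x w = 1) ↔ (w ∈ T ∧ y w = 1)) : setSign S x = setSign T y := by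
  classical
  exact Finset.prod_congr rfl fun w _ => by simp only [h w]

lemma setSign_congr_right {S : Set V} {x y : V → Fin 2} (h : ∀ w ∈ S, x w = y w) :
    setSign S x = setSign S y :=
  setSign_congr fun w => and_congr_right fun hw => by rw [h w hw]

lemma setSign_zero (S : Set V) : setSign S (0 : V → Fin 2) = 1 := by
  simp [setSign]

lemma setSign_empty (x : V → Fin 2) : setSign ∅ x = 1 := by
  simp [setSign]

open scoped Classical in
lemma setSign_singleton (a : V) (x : V → Fin 2) :
    setSign {a} x = if x a = 1 then -1 else 1 := by
  unfold setSign
  rw [Finset.prod_eq_single a] <;> simp +contextual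

lemma setSign_symmDiff (S T : Set V) (x : V → Fin 2) :
    setSign (S ∆ T) x = setSign S x * setSign T x := by
  classical
  unfold setSign
  rw [← Finset.prod_mul_distrib]
  refine Finset.prod_congr rfl fun w _ => ?_
  by_cases hS : w ∈ S <;> by_cases hT : w ∈ T <;> by_cases hx : x w = 1 <;>
    simp [Set.mem_symmDiff, hS, hT, hx]

lemma setSign_sq (S : Set V) (x : V → Fin 2) : setSign S x ^ 2 = 1 := by
  rw [sq, ← setSign_symmDiff, symmDiff_self, Set.bot_eq_empty, setSign_empty]

lemma setSign_insert {S : Set V} {a : V} (ha : a ∉ S) (x : V → Fin 2) :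
    setSign (insert a S) x = setSign {a} x * setSign S x := by
  have : insert a S = {a} ∆ S :=
    (Set.insert_eq a S).trans (Set.disjoint_singleton_left.2 ha).symmDiff_eq_sup.symm
  rw [this, setSign_symmDiff]

lemma setSign_insert_of_eq_zero (S : Set V) {a : V} {x : V → Fin 2} (ha : x a = 0) :
    setSign (insert a S) x = setSign S x :=
  setSign_congr fun w => by grind

variable [DecidableEq V]

lemma setSign_update_zero (S : Set V) (x : V → Fin 2) (u : V) :
    setSign S (Function.update x u 0) = setSign (S \ {u}) x :=
  setSign_congr fun w => by by_cases h : w = u <;> simp [h]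

lemma setSign_update_of_notMem {S : Set V} {u : V} (hu : u ∉ S) (x : V → Fin 2) (t : Fin 2) :
    setSign S (Function.update x u t) = setSign S x :=
  setSign_congr_right fun _ hw => Function.update_of_ne (ne_of_mem_of_not_mem hw hu) _ _

lemma setSign_update_one_of_mem {S : Set V} {u : V} (hu : u ∈ S) {x : V → Fin 2}
    (hx : x u = 0) : setSign S (Function.update x u 1) = -setSign S x := by
  have hS : S = insert u (S \ {u}) := (Set.insert_sdiff_self_of_mem hu).symm
  have hu' : u ∉ S \ {u} := fun h => h.2 rfl
  rw [hS, setSign_insert hu', setSign_update_of_notMem hu', setSign_insert_of_eq_zero _ hx,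
    setSign_singleton, Function.update_self, if_pos rfl, neg_one_mul]

end SetSign

/-! ### Quadratic phase functions -/

section GraphPhase

lemma bitString_induction [Finite V] [DecidableEq V] {p : (V → Fin 2) → Prop} (zero : p 0)
    (update_one : ∀ u x, x u = 0 → p x → p (Function.update x u 1)) (x : V → Fin 2) : p x := by
  have := Fintype.ofFinite V
  induction hs : (Finset.univ.filter fun v => x v = 1) using Finset.induction_on
    generalizing x with
  | empty =>
    convert zero
    ext v
    have : x v ≠ 1 := by simpa using Finset.ext_iff.1 hs v
    simp only [Pi.zero_apply]
    omega
  | insert u s hu ih =>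
    have hx : x u = 1 := by simpa using Finset.ext_iff.1 hs u
    have := update_one u (Function.update x u 0) (by simp) (ih _ ?_)
    · rwa [Function.update_idem, ← hx, Function.update_eq_self] at this
    · ext v
      have := Finset.ext_iff.1 hs v
      by_cases hv : v = u
      · subst hv; simp [hu]
      · simpa [hv] using this

variable [Fintype V] [DecidableEq V]

open scoped Classical in
/-- The sign that the controlled-`Z` gates of the edges of `Γ` give to a basis state. -/
noncomputable def edgeSign (Γ : SimpleGraph V) (x : V → Fin 2) : ℂ :=
  ∏ e : Sym2 V, if e ∈ Γ.edgeSet ∧ ∀ v ∈ e, x v = 1 then (-1 : ℂ) else 1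

lemma edgeSign_zero (Γ : SimpleGraph V) : edgeSign Γ 0 = 1 := by
  classical
  refine Finset.prod_eq_one fun e _ => if_neg fun h => ?_
  induction e with | _ a b => simpa using h.2 a (by simp)

open scoped Classical in
lemma setSign_neighborSet (Γ : SimpleGraph V) (u : V) (x : V → Fin 2) :
    setSign (Γ.neighborSet u) x =
      ∏ e : Sym2 V, if u ∈ e ∧ e ∈ Γ.edgeSet ∧ ∀ v ∈ e, v ≠ u → x v = 1 then -1 else 1 := by
  unfold setSign
  refine Fintype.prod_of_injective (fun w => s(u, w)) (fun _ _ => Sym2.congr_right.1) _ _ ?_ ?_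
  · intro e he
    exact if_neg fun ⟨⟨w, hw⟩, _⟩ => he ⟨w, hw.symm⟩
  · intro w
    by_cases h : Γ.Adj u w
    · simp [h, h.ne']
    · simp [h]

lemma edgeSign_update_one (Γ : SimpleGraph V) {x : V → Fin 2} {u : V} (hu : x u = 0) :
    edgeSign Γ (Function.update x u 1) = setSign (Γ.neighborSet u) x * edgeSign Γ x := by
  classical
  unfold edgeSign
  rw [setSign_neighborSet, ← Finset.prod_mul_distrib]
  refine Finset.prod_congr rfl fun e _ => ?_
  by_cases hue : u ∈ e
  · have hx : ¬ ∀ v ∈ e, x v = 1 := fun h => by simpa [hu] using h u hue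
    have hupd : (∀ v ∈ e, Function.update x u 1 v = 1) ↔ ∀ v ∈ e, v ≠ u → x v = 1 :=
      forall₂_congr fun v _ => by by_cases hv : v = u <;> simp [hv]
    simp only [hue, hx, hupd, true_and, and_false, if_false, mul_one]
  · have hupd : (∀ v ∈ e, Function.update x u 1 v = 1) ↔ ∀ v ∈ e, x v = 1 :=
      forall₂_congr fun v hv => by rw [Function.update_of_ne (ne_of_mem_of_not_mem hv hue)]
    simp only [hue, hupd, false_and, if_false, one_mul]

/-- The amplitudes, normalized to `1` at `0`, of the state of a graph without hollow nodes whose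
node `v` contributes the phase `w v` when its bit is set. -/
noncomputable def graphPhase (Γ : SimpleGraph V) (w : V → ℂ) (x : V → Fin 2) : ℂ :=
  edgeSign Γ x * ∏ v, if x v = 1 then w v else 1

lemma graphPhase_zero (Γ : SimpleGraph V) (w : V → ℂ) : graphPhase Γ w 0 = 1 := by
  simp [graphPhase, edgeSign_zero]

lemma graphPhase_update_one (Γ : SimpleGraph V) (w : V → ℂ) {x : V → Fin 2} {u : V}
    (hu : x u = 0) : graphPhase Γ w (Function.update x u 1) =
      w u * setSign (Γ.neighborSet u) x * graphPhase Γ w x := by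
  have hw : (∏ v, if Function.update x u 1 v = 1 then w v else 1) =
      w u * ∏ v, if x v = 1 then w v else 1 := by
    rw [← Fintype.prod_ite_eq' u w, ← Finset.prod_mul_distrib]
    refine Finset.prod_congr rfl fun v _ => ?_
    by_cases hv : v = u <;> simp [hv, hu]
  rw [graphPhase, graphPhase, edgeSign_update_one Γ hu, hw]
  ring

lemma graphPhase_ne_zero (Γ : SimpleGraph V) {w : V → ℂ} (hw : ∀ v, w v ≠ 0) (x : V → Fin 2) :
    graphPhase Γ w x ≠ 0 := by
  induction x using bitString_induction with
  | zero => simp [graphPhase_zero]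
  | update_one u x hu ih =>
    rw [graphPhase_update_one Γ w hu]
    have hsign : setSign (Γ.neighborSet u) x ≠ 0 := fun h => by
      simpa [h] using setSign_sq (Γ.neighborSet u) x
    exact mul_ne_zero (mul_ne_zero (hw u) hsign) ih

lemma eq_smul_graphPhase {f : (V → Fin 2) → ℂ} {Γ : SimpleGraph V} {w : V → ℂ}
    (hf : ∀ u x, x u = 0 →
      f (Function.update x u 1) = w u * setSign (Γ.neighborSet u) x * f x) :
    f = f 0 • graphPhase Γ w := by
  ext x
  induction x using bitString_induction with
  | zero => simp [graphPhase_zero]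
  | update_one u x hu ih =>
    rw [hf u x hu, ih, Pi.smul_apply, Pi.smul_apply, graphPhase_update_one Γ w hu]
    simp only [smul_eq_mul]
    ring

lemma weight_eq_of_graphPhase_eq {Γ Γ' : SimpleGraph V} {w w' : V → ℂ}
    (h : graphPhase Γ w = graphPhase Γ' w') : w = w' := by
  ext u
  simpa [graphPhase_update_one, setSign_zero, graphPhase_zero] using
    congrFun h (Function.update 0 u 1)

lemma graph_eq_of_graphPhase_eq {Γ Γ' : SimpleGraph V} {w w' : V → ℂ} (hw : ∀ v, w v ≠ 0)
    (h : graphPhase Γ w = graphPhase Γ' w') : Γ = Γ' := by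
  classical
  have hsign {Δ : SimpleGraph V} (u v : V) :
      setSign (Δ.neighborSet u) (Function.update 0 v 1) = if Δ.Adj u v then -1 else 1 := by
    split_ifs with huv
    · rw [setSign_update_one_of_mem (S := Δ.neighborSet u) huv rfl, setSign_zero]
    · rw [setSign_update_of_notMem (S := Δ.neighborSet u) huv, setSign_zero]
  ext u v
  obtain rfl | huv := eq_or_ne u v
  · simp
  have hu : (Function.update 0 v 1 : V → Fin 2) u = 0 := by simp [huv]
  have huv := congrFun h (Function.update (Function.update 0 v 1) u 1)
  rw [graphPhase_update_one Γ w hu, graphPhase_update_one Γ' w' hu, h,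
    weight_eq_of_graphPhase_eq h, hsign, hsign] at huv
  have hw' : ∀ v, w' v ≠ 0 := weight_eq_of_graphPhase_eq h ▸ hw
  have := mul_left_cancel₀ (hw' u) (mul_right_cancel₀ (graphPhase_ne_zero Γ' hw' _) huv)
  split_ifs at this <;> first | tauto | norm_num at this

end GraphPhase

/-! ### Layers of Hadamard gates -/

section Hadamard

/-- The factor `1 / √2` of the Hadamard gate. -/
noncomputable def hadamardCoeff : ℂ := ((1 / Real.sqrt 2 : ℝ) : ℂ)

lemma hadamardCoeff_sq : hadamardCoeff ^ 2 = 1 / 2 := by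
  rw [hadamardCoeff, ← Complex.ofReal_pow, div_pow, Real.sq_sqrt zero_le_two]
  norm_num

lemma hadamardCoeff_ne_zero : hadamardCoeff ≠ 0 := by
  simp [hadamardCoeff]

lemma norm_hadamardCoeff_mul_one_add {z : ℂ} (hz : z ^ 2 = -1) :
    ‖hadamardCoeff * (1 + z)‖ = 1 := by
  have hsq : (hadamardCoeff * (1 + z)) ^ 2 = z := by
    rw [mul_pow, hadamardCoeff_sq]
    linear_combination 1 / 2 * hz
  have hz' : ‖z‖ = 1 := by
    rw [← pow_eq_one_iff_of_nonneg (norm_nonneg _) two_ne_zero, ← norm_pow, hz, norm_neg, norm_one]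
  rw [← pow_eq_one_iff_of_nonneg (norm_nonneg _) two_ne_zero, ← norm_pow, hsq, hz']

lemma gateH_apply (i j : Fin 2) :
    gateH i j = hadamardCoeff * if i = 1 ∧ j = 1 then -1 else 1 := by
  fin_cases i <;> fin_cases j <;> simp [gateH, hadamardCoeff]

lemma gateH_mul_gateH : gateH * gateH = 1 := by
  ext i j
  rw [Matrix.mul_apply, Fin.sum_univ_two]
  simp only [gateH_apply]
  fin_cases i <;> fin_cases j <;> simp <;> linear_combination 2 * hadamardCoeff_sq

variable [Fintype V]

lemma tensorGate_diagonal (d : V → Fin 2 → ℂ) :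
    tensorGate (fun v => Matrix.diagonal (d v)) = Matrix.diagonal fun x => ∏ v, d v (x v) := by
  ext x y
  simp only [tensorGate, Matrix.of_apply]
  by_cases h : x = y
  · subst h; simp
  · obtain ⟨v, hv⟩ := Function.ne_iff.1 h
    rw [Matrix.diagonal_apply_ne _ h]
    exact Finset.prod_eq_zero (Finset.mem_univ v) (Matrix.diagonal_apply_ne _ hv)

lemma tensorGate_mul [DecidableEq V] (U W : V → Matrix (Fin 2) (Fin 2) ℂ) :
    tensorGate U * tensorGate W = tensorGate fun v => U v * W v := by
  ext x y
  simp only [tensorGate, Matrix.mul_apply, Matrix.of_apply, ← Finset.prod_mul_distrib]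
  rw [Finset.prod_univ_sum, Fintype.piFinset_univ]

open scoped Classical in
/-- The operator that applies a Hadamard gate to each qubit in `A`. -/
noncomputable def hadamardLayer (A : Set V) : Matrix (V → Fin 2) (V → Fin 2) ℂ :=
  tensorGate fun v => if v ∈ A then gateH else 1

lemma hadamardLayer_empty : hadamardLayer (∅ : Set V) = 1 := by
  simpa [hadamardLayer] using tensorGate_diagonal (fun (_ : V) _ => 1)

lemma hadamardLayer_apply_eq_zero {A : Set V} {x y : V → Fin 2} {v : V} (hv : v ∉ A)
    (hxy : x v ≠ y v) : hadamardLayer A x y = 0 :=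
  Finset.prod_eq_zero (Finset.mem_univ v) (by simp [hv, hxy])

lemma exists_ne_zero_of_hadamardLayer_mulVec_ne_zero [DecidableEq V] {A : Set V}
    {f : (V → Fin 2) → ℂ} {x : V → Fin 2} (hx : (hadamardLayer A *ᵥ f) x ≠ 0) :
    ∃ y, (∀ v ∉ A, y v = x v) ∧ f y ≠ 0 := by
  obtain ⟨y, -, hy⟩ := Finset.exists_ne_zero_of_sum_ne_zero hx
  refine ⟨y, fun v hv => ?_, right_ne_zero_of_mul hy⟩
  by_contra hne
  exact left_ne_zero_of_mul hy (hadamardLayer_apply_eq_zero hv (Ne.symm hne))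

variable [DecidableEq V]

lemma hadamardLayer_mul (A B : Set V) :
    hadamardLayer A * hadamardLayer B = hadamardLayer (A ∆ B) := by
  classical
  unfold hadamardLayer
  rw [tensorGate_mul]
  congr 1
  ext1 v
  by_cases hA : v ∈ A <;> by_cases hB : v ∈ B <;>
    simp [hA, hB, Set.mem_symmDiff, gateH_mul_gateH]

lemma hadamardLayer_mulVec_cancel (A : Set V) (f : (V → Fin 2) → ℂ) :
    hadamardLayer A *ᵥ (hadamardLayer A *ᵥ f) = f := by
  rw [Matrix.mulVec_mulVec, hadamardLayer_mul, symmDiff_self, Set.bot_eq_empty,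
    hadamardLayer_empty, Matrix.one_mulVec]

lemma hadamardLayer_singleton_apply_update (v : V) (x : V → Fin 2) (t : Fin 2) :
    hadamardLayer {v} x (Function.update x v t) = gateH (x v) t := by
  classical
  simp only [hadamardLayer, tensorGate, Matrix.of_apply]
  rw [Finset.prod_eq_single v] <;> simp +contextual [Matrix.one_apply]

lemma hadamardLayer_singleton_mulVec (v : V) (f : (V → Fin 2) → ℂ) (x : V → Fin 2) :
    (hadamardLayer {v} *ᵥ f) x = hadamardCoeff *
      (f (Function.update x v 0) + setSign {v} x * f (Function.update x v 1)) := by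
  have hsum : (hadamardLayer {v} *ᵥ f) x =
      ∑ t : Fin 2, gateH (x v) t * f (Function.update x v t) := by
    rw [Matrix.mulVec, dotProduct]
    refine (Fintype.sum_of_injective (fun t => Function.update x v t)
      (Function.update_injective x v) _ _ (fun y hy => ?_) fun t => ?_).symm
    · obtain ⟨w, hwv, hw⟩ : ∃ w ≠ v, x w ≠ y w := by
        by_contra! hxy
        exact hy ⟨y v, Function.update_eq_iff.2 ⟨rfl, hxy⟩⟩
      have hzero : hadamardLayer {v} x y = 0 := hadamardLayer_apply_eq_zero (A := {v}) hwv hw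
      rw [hzero, zero_mul]
    · rw [hadamardLayer_singleton_apply_update]
  rw [hsum, Fin.sum_univ_two, gateH_apply, gateH_apply, setSign_singleton]
  by_cases h : x v = 1 <;> simp [h] <;> ring

end Hadamard

/-! ### The state of a graph -/

section State

open scoped Classical in
/-- The phase that the loop and the minus sign of `v` contribute when the bit of `v` is set. -/
noncomputable def nodeWeight (G : StabGraph V) (v : V) : ℂ :=
  (if v ∈ G.loops then Complex.I else 1) * (if v ∈ G.minus then -1 else 1)

lemma nodeWeight_ne_zero (G : StabGraph V) (v : V) : G.nodeWeight v ≠ 0 := by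
  classical
  unfold nodeWeight
  split_ifs <;> simp

lemma nodeWeight_sq_of_mem_loops {G : StabGraph V} {v : V} (hv : v ∈ G.loops) :
    G.nodeWeight v ^ 2 = -1 := by
  by_cases hm : v ∈ G.minus <;> simp [nodeWeight, hv, hm]

lemma nodeWeight_sq_of_notMem_loops {G : StabGraph V} {v : V} (hv : v ∉ G.loops) :
    G.nodeWeight v ^ 2 = 1 := by
  by_cases hm : v ∈ G.minus <;> simp [nodeWeight, hv, hm]

lemma mem_loops_iff_and_mem_minus_iff_of_nodeWeight_eq {G G' : StabGraph V} {v : V}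
    (h : G.nodeWeight v = G'.nodeWeight v) :
    (v ∈ G.loops ↔ v ∈ G'.loops) ∧ (v ∈ G.minus ↔ v ∈ G'.minus) := by
  unfold nodeWeight at h
  by_cases hl : v ∈ G.loops <;> by_cases hl' : v ∈ G'.loops <;>
    by_cases hm : v ∈ G.minus <;> by_cases hm' : v ∈ G'.minus <;>
    simp [hl, hl', hm, hm', Complex.ext_iff] at h ⊢ <;> norm_num at h

open scoped Classical in
lemma terminalGate_eq (G : StabGraph V) (v : V) :
    G.terminalGate v = (if v ∈ G.hollow then gateH else 1) *
      Matrix.diagonal fun t : Fin 2 => if t = 1 then G.nodeWeight v else 1 := by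
  rw [terminalGate, mul_assoc]
  congr 1
  ext i j
  by_cases hl : v ∈ G.loops <;> by_cases hm : v ∈ G.minus <;> fin_cases i <;> fin_cases j <;>
    simp [hl, hm, gateS, gateZ, nodeWeight]

variable [Fintype V] [DecidableEq V]

/-- The amplitudes of the state of `G` before the Hadamard gates of the hollow nodes, normalized
to `1` at `0`. -/
noncomputable def phase (G : StabGraph V) : (V → Fin 2) → ℂ := graphPhase G.edges G.nodeWeight

lemma phase_zero (G : StabGraph V) : G.phase 0 = 1 := graphPhase_zero _ _

lemma phase_update_one (G : StabGraph V) {x : V → Fin 2} {u : V} (hu : x u = 0) :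
    G.phase (Function.update x u 1) = G.nodeWeight u * setSign (G.nbr u) x * G.phase x :=
  graphPhase_update_one _ _ hu

lemma eq_smul_phase {f : (V → Fin 2) → ℂ} {G : StabGraph V}
    (hf : ∀ u x, x u = 0 →
      f (Function.update x u 1) = G.nodeWeight u * setSign (G.nbr u) x * f x) :
    f = f 0 • G.phase :=
  eq_smul_graphPhase hf

lemma state_eq (G : StabGraph V) :
    G.state = hadamardCoeff ^ Fintype.card V • (hadamardLayer G.hollow *ᵥ G.phase) := by
  classical
  have hplus : tensorGate (fun _ : V => gateH) *ᵥ ketZero =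
      fun _ => hadamardCoeff ^ Fintype.card V := by
    ext x
    simp [ketZero, tensorGate, gateH_apply]
  have hterminal : tensorGate G.terminalGate = hadamardLayer G.hollow *
      Matrix.diagonal fun x : V → Fin 2 => ∏ v, if x v = 1 then G.nodeWeight v else 1 := by
    rw [← tensorGate_diagonal fun v t => if t = 1 then G.nodeWeight v else 1, hadamardLayer,
      tensorGate_mul]
    exact congrArg tensorGate (funext G.terminalGate_eq)
  rw [state, hplus, hterminal, ← Matrix.mulVec_mulVec, ← Matrix.mulVec_smul]
  congr 1
  ext x
  rw [czLayer, Matrix.mulVec_diagonal, Matrix.mulVec_diagonal, Pi.smul_apply, phase, graphPhase,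
    edgeSign, smul_eq_mul]
  ring

lemma exists_state_ne_zero (G : StabGraph V) (z : V → Fin 2) :
    ∃ x, (∀ v ∉ G.hollow, x v = z v) ∧ G.state x ≠ 0 := by
  have hz : (hadamardLayer G.hollow *ᵥ (hadamardLayer G.hollow *ᵥ G.phase)) z ≠ 0 := by
    rw [hadamardLayer_mulVec_cancel]
    exact graphPhase_ne_zero _ G.nodeWeight_ne_zero z
  obtain ⟨x, hxz, hx⟩ := exists_ne_zero_of_hadamardLayer_mulVec_ne_zero hz
  refine ⟨x, hxz, ?_⟩
  rw [state_eq]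
  exact mul_ne_zero (pow_ne_zero _ hadamardCoeff_ne_zero) hx

lemma Equivalent.refl (G : StabGraph V) : G.Equivalent G := ⟨1, norm_one, (one_smul ℂ _).symm⟩

lemma Equivalent.symm {G G' : StabGraph V} (h : G.Equivalent G') : G'.Equivalent G := by
  obtain ⟨c, hc, h⟩ := h
  have hc0 : c ≠ 0 := norm_ne_zero_iff.1 (hc.trans_ne one_ne_zero)
  exact ⟨c⁻¹, by rw [norm_inv, hc, inv_one], by rw [h, inv_smul_smul₀ hc0]⟩

lemma Equivalent.trans {G G' G'' : StabGraph V} (h : G.Equivalent G')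
    (h' : G'.Equivalent G'') : G.Equivalent G'' := by
  obtain ⟨c, hc, h⟩ := h
  obtain ⟨d, hd, h'⟩ := h'
  exact ⟨d * c, by rw [norm_mul, hd, hc, one_mul], by rw [h', h, smul_smul]⟩

lemma equivalent_of_hadamardLayer_mulVec_phase {G G' : StabGraph V} {A : Set V} {c : ℂ}
    (hA : G'.hollow = G.hollow ∆ A) (hc : ‖c‖ = 1)
    (h : hadamardLayer A *ᵥ G.phase = c • G'.phase) : G.Equivalent G' := by
  refine Equivalent.symm ⟨c, hc, ?_⟩
  have hA' : G.hollow = G'.hollow ∆ A := by rw [hA, symmDiff_symmDiff_cancel_right]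
  rw [state_eq, state_eq, smul_comm, ← Matrix.mulVec_smul _ c, ← h, Matrix.mulVec_mulVec,
    hadamardLayer_mul, ← hA']

lemma Equivalent.phase_eq_of_hollow_eq {G G' : StabGraph V} (h : G.Equivalent G')
    (hH : G.hollow = G'.hollow) : G.phase = G'.phase := by
  obtain ⟨c, -, h⟩ := h
  rw [state_eq, state_eq, smul_comm, hH] at h
  have hphase := congrArg (hadamardLayer G'.hollow *ᵥ ·)
    (smul_right_injective _ (pow_ne_zero (Fintype.card V) hadamardCoeff_ne_zero) h)
  simp only [Matrix.mulVec_smul, hadamardLayer_mulVec_cancel] at hphase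
  have hc : c = 1 := by simpa [phase_zero] using (congrFun hphase 0).symm
  rw [hphase, hc, one_smul]

lemma Equivalent.eq_of_hollow_eq {G G' : StabGraph V} (h : G.Equivalent G')
    (hH : G.hollow = G'.hollow) : G = G' := by
  have hphase := h.phase_eq_of_hollow_eq hH
  have hlm := fun v => mem_loops_iff_and_mem_minus_iff_of_nodeWeight_eq
    (congrFun (weight_eq_of_graphPhase_eq hphase) v)
  exact StabGraph.ext (graph_eq_of_graphPhase_eq G.nodeWeight_ne_zero hphase) hH
    (Set.ext fun v => (hlm v).1) (Set.ext fun v => (hlm v).2)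

end State

/-! ### Local complementation and the rules as set equations -/

section Rules

lemma mem_nbr_comm {G : StabGraph V} {u w : V} : u ∈ G.nbr w ↔ w ∈ G.nbr u := G.edges.adj_comm w u

lemma notMem_nbr_self (G : StabGraph V) (u : V) : u ∉ G.nbr u := G.edges.irrefl

lemma ne_of_mem_nbr {G : StabGraph V} {u w : V} (h : w ∈ G.nbr u) : u ≠ w := G.edges.ne_of_adj h

lemma mem_nbr_localComp {G : StabGraph V} {v u w : V} :
    w ∈ (G.localComp v).nbr u ↔ u ≠ w ∧ Xor (w ∈ G.nbr u) (u ∈ G.nbr v ∧ w ∈ G.nbr v) := Iff.rfl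

lemma nbr_localComp_of_notMem {G : StabGraph V} {v u : V} (h : u ∉ G.nbr v) :
    (G.localComp v).nbr u = G.nbr u := by
  ext w
  grind [mem_nbr_localComp, ne_of_mem_nbr, Xor]

lemma nbr_localComp_self (G : StabGraph V) (v : V) : (G.localComp v).nbr v = G.nbr v :=
  nbr_localComp_of_notMem (G.notMem_nbr_self v)

lemma insert_nbr_localComp_of_mem {G : StabGraph V} {v u : V} (h : u ∈ G.nbr v) :
    insert u ((G.localComp v).nbr u) = (G.nbr u \ {v}) ∆ insert v (G.nbr v) := by
  ext w
  have := G.notMem_nbr_self u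
  simp only [Set.mem_insert_iff, mem_nbr_localComp, Set.mem_symmDiff, Set.mem_sdiff,
    Set.mem_singleton_iff]
  grind [notMem_nbr_self, mem_nbr_comm, Xor]

lemma nbr_localCompEdge_left {G : StabGraph V} {a b : V} (hab : b ∈ G.nbr a) :
    (G.localCompEdge a b).nbr a = insert b (G.nbr b \ {a}) := by
  ext w
  have ha := G.notMem_nbr_self a
  have hb := G.notMem_nbr_self b
  simp only [localCompEdge, mem_nbr_localComp, Set.mem_insert_iff, Set.mem_sdiff,
    Set.mem_singleton_iff]
  grind [mem_nbr_comm, Xor]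

lemma nbr_localCompEdge_right {G : StabGraph V} {a b : V} (hab : b ∈ G.nbr a) :
    (G.localCompEdge a b).nbr b = insert a (G.nbr a \ {b}) := by
  ext w
  have ha := G.notMem_nbr_self a
  have hb := G.notMem_nbr_self b
  simp only [localCompEdge, mem_nbr_localComp, Set.mem_insert_iff, Set.mem_sdiff,
    Set.mem_singleton_iff]
  grind [mem_nbr_comm, Xor]

open scoped Classical in
lemma nbr_localCompEdge_of_ne {G : StabGraph V} {a b u : V} (hab : b ∈ G.nbr a) (hua : u ≠ a)
    (hub : u ≠ b) :
    (G.localCompEdge a b).nbr u = (G.nbr u \ {a, b}) ∆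
      ((if u ∈ G.nbr a then (G.localCompEdge a b).nbr a else ∅) ∆
        (if u ∈ G.nbr b then (G.localCompEdge a b).nbr b else ∅)) := by
  ext w
  have ha := G.notMem_nbr_self a
  have hb := G.notMem_nbr_self b
  have hu := G.notMem_nbr_self u
  rw [nbr_localCompEdge_left hab, nbr_localCompEdge_right hab]
  by_cases hau : u ∈ G.nbr a <;> by_cases hbu : u ∈ G.nbr b <;>
    simp only [localCompEdge, mem_nbr_localComp, Set.mem_symmDiff, Set.mem_singleton_iff, hau, hbu,
      if_true, if_false, Set.mem_sdiff, Set.mem_insert_iff, Set.mem_empty_iff_false] <;>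
    grind [mem_nbr_comm, Xor]

lemma ruleE1_edges (G : StabGraph V) (v : V) : (G.ruleE1 v).edges = (G.localComp v).edges := by
  dsimp only [ruleE1]
  split_ifs <;> rfl

lemma ruleE1_nbr (G : StabGraph V) (v : V) : (G.ruleE1 v).nbr = (G.localComp v).nbr := by
  unfold nbr
  rw [ruleE1_edges]

lemma ruleE1_hollow (G : StabGraph V) (v : V) : (G.ruleE1 v).hollow = G.hollow ∆ {v} := by
  dsimp only [ruleE1]
  split_ifs <;> rfl

lemma ruleE1_loops (G : StabGraph V) (v : V) : (G.ruleE1 v).loops = G.loops ∆ G.nbr v := by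
  dsimp only [ruleE1]
  split_ifs <;> rfl

open scoped Classical in
lemma ruleE1_minus (G : StabGraph V) (v : V) : (G.ruleE1 v).minus =
    G.minus ∆ (G.loops ∩ G.nbr v) ∆ {v} ∆ (if v ∈ G.minus then ∅ else G.nbr v) := by
  have hv : v ∈ ((((G.flipFill {v}).localComp v).advance (G.nbr v)).flipSign {v}).minus ↔
      v ∉ G.minus := by
    simp [flipSign, advance, localComp, flipFill, Set.mem_symmDiff, notMem_nbr_self]
  have hnbr : ((((G.flipFill {v}).localComp v).advance (G.nbr v)).flipSign {v}).nbr v =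
      G.nbr v := G.nbr_localComp_self v
  simp only [ruleE1, hv, hnbr]
  by_cases hm : v ∈ G.minus
  · rw [if_neg (not_not.2 hm), if_pos hm, ← Set.bot_eq_empty, symmDiff_bot]
    rfl
  · rw [if_pos hm, if_neg hm]
    rfl

lemma ruleE2_edges (G : StabGraph V) (a b : V) :
    (G.ruleE2 a b).edges = (G.localCompEdge a b).edges := by
  unfold ruleE2
  split_ifs <;> rfl

lemma ruleE2_nbr (G : StabGraph V) (a b : V) :
    (G.ruleE2 a b).nbr = (G.localCompEdge a b).nbr := by
  unfold nbr
  rw [ruleE2_edges]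

lemma ruleE2_hollow (G : StabGraph V) (a b : V) :
    (G.ruleE2 a b).hollow = G.hollow ∆ {a, b} := by
  unfold ruleE2
  split_ifs <;> rfl

lemma ruleE2_loops (G : StabGraph V) (a b : V) : (G.ruleE2 a b).loops = G.loops := by
  unfold ruleE2
  split_ifs <;> rfl

open scoped Classical in
lemma ruleE2_minus (G : StabGraph V) (a b : V) : (G.ruleE2 a b).minus =
    G.minus ∆ (G.nbr a ∩ G.nbr b) ∆
      (if a ∈ G.minus then {a} ∪ (G.localCompEdge a b).nbr a else ∅) ∆
      (if b ∈ G.minus then {b} ∪ (G.localCompEdge a b).nbr b else ∅) := by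
  unfold ruleE2
  split_ifs <;> simp only [← Set.bot_eq_empty, symmDiff_bot] <;> rfl

lemma ruleEi_edges (G : StabGraph V) (h s : V) :
    (G.ruleEi h s).edges = ((G.localComp s).localComp h).edges := by
  dsimp only [ruleEi]
  split_ifs <;> rfl

lemma ruleEi_hollow (G : StabGraph V) (h s : V) :
    (G.ruleEi h s).hollow = G.hollow ∆ {h, s} := by
  dsimp only [ruleEi]
  split_ifs <;> rfl

lemma ruleEi_loops (G : StabGraph V) (h s : V) :
    (G.ruleEi h s).loops = (G.loops \ {s}) ∆ ((G.localComp s).localComp h).nbr s := by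
  dsimp only [ruleEi]
  split_ifs <;> rfl

open scoped Classical in
lemma ruleEi_minus (G : StabGraph V) (h s : V) : (G.ruleEi h s).minus =
    G.minus ∆ ((G.loops \ {s}) ∩ ((G.localComp s).localComp h).nbr s) ∆ (G.nbr s ∩ G.nbr h) ∆
      (if s ∈ G.minus then {s} ∪ ((G.localComp s).localComp h).nbr s else ∅) ∆
      (if h ∈ G.minus then ((G.localComp s).localComp h).nbr h else ∅) := by
  unfold ruleEi
  split_ifs <;> simp only [← Set.bot_eq_empty, symmDiff_bot] <;> rfl

lemma ruleEi_eq_ruleE1_ruleE1 {G : StabGraph V} {h s : V} (hs : s ∈ G.loops) (hh : h ∉ G.loops)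
    (hhs : s ∈ G.nbr h) : G.ruleEi h s = (G.ruleE1 s).ruleE1 h := by
  have hedges : ((G.ruleE1 s).localComp h).edges = ((G.localComp s).localComp h).edges := by
    simp only [localComp, ruleE1_edges]
  have hne : h ≠ s := ne_of_mem_nbr hhs
  have hhh := G.notMem_nbr_self h
  have hss := G.notMem_nbr_self s
  refine StabGraph.ext ?_ ?_ ?_ ?_
  · rw [ruleEi_edges, ruleE1_edges, hedges]
  · rw [ruleEi_hollow, ruleE1_hollow, ruleE1_hollow, symmDiff_assoc,
      (Set.disjoint_singleton.2 hne.symm).symmDiff_eq_sup, sup_comm]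
    rfl
  · ext u
    simp only [ruleEi_loops, ruleE1_loops, ruleE1_nbr, Set.mem_symmDiff, Set.mem_sdiff,
      Set.mem_singleton_iff, mem_nbr_localComp]
    grind [mem_nbr_comm, Xor]
  · have hminus : h ∈ (G.ruleE1 s).minus ↔ (h ∈ G.minus ↔ s ∈ G.minus) := by
      simp only [ruleE1_minus, Set.mem_symmDiff, Set.mem_inter_iff, Set.mem_singleton_iff]
      by_cases hm : s ∈ G.minus <;> simp only [hm, if_true, if_false] <;> grind [mem_nbr_comm]
    ext u
    classical
    rw [ruleE1_minus, if_congr hminus rfl rfl, ruleEi_minus]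
    by_cases hms : s ∈ G.minus <;> by_cases hmh : h ∈ G.minus <;>
      simp only [ruleE1_minus, ruleE1_loops, ruleE1_nbr, nbr_localComp_self, hms, hmh, if_true,
        if_false, iff_true, iff_false, not_true, not_false_eq_true, Set.mem_symmDiff,
        Set.mem_inter_iff, Set.mem_sdiff, Set.mem_union, Set.mem_singleton_iff,
        Set.mem_empty_iff_false, mem_nbr_localComp] <;>
      by_cases hus : u = s <;> by_cases huh : u = h <;> grind [mem_nbr_comm, Xor]

lemma ruleEii_eq_ruleE2 (G : StabGraph V) (a b : V) : G.ruleEii a b = G.ruleE2 a b := rfl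

end Rules

/-! ### Soundness of the rules -/

section Soundness

lemma nodeWeight_ruleE1_self {G : StabGraph V} {v : V} (hv : v ∈ G.loops) :
    (G.ruleE1 v).nodeWeight v = -G.nodeWeight v := by
  by_cases hm : v ∈ G.minus <;>
    simp [nodeWeight, ruleE1_loops, ruleE1_minus, Set.mem_symmDiff, hv, G.notMem_nbr_self v, hm]

lemma nodeWeight_ruleE1_of_mem {G : StabGraph V} {u v : V} (hv : v ∈ G.loops)
    (hu : u ∈ G.nbr v) : (G.ruleE1 v).nodeWeight u = -(G.nodeWeight v * G.nodeWeight u) := by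
  have huv : u ≠ v := (ne_of_mem_nbr hu).symm
  by_cases hmv : v ∈ G.minus <;> by_cases hmu : u ∈ G.minus <;> by_cases hlu : u ∈ G.loops <;>
    simp [nodeWeight, ruleE1_loops, ruleE1_minus, Set.mem_symmDiff, hv, hu, huv, hmv, hmu, hlu]

lemma nodeWeight_ruleE1_of_notMem {G : StabGraph V} {u v : V} (hu : u ∉ G.nbr v) (huv : u ≠ v) :
    (G.ruleE1 v).nodeWeight u = G.nodeWeight u := by
  by_cases hmv : v ∈ G.minus <;> by_cases hmu : u ∈ G.minus <;> by_cases hlu : u ∈ G.loops <;>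
    simp [nodeWeight, ruleE1_loops, ruleE1_minus, Set.mem_symmDiff, hu, huv, hmv, hmu, hlu]

lemma nodeWeight_ruleE2_left {G : StabGraph V} {a b : V} (hab : b ∈ G.nbr a) (ha : a ∉ G.loops)
    (hb : b ∉ G.loops) : (G.ruleE2 a b).nodeWeight a = G.nodeWeight b := by
  have hne : a ≠ b := ne_of_mem_nbr hab
  by_cases hma : a ∈ G.minus <;> by_cases hmb : b ∈ G.minus <;>
    simp [nodeWeight, ruleE2_loops, ruleE2_minus, nbr_localCompEdge_left hab,
      nbr_localCompEdge_right hab, Set.mem_symmDiff, G.notMem_nbr_self a, ha, hb, hne, hma, hmb]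

lemma nodeWeight_ruleE2_right {G : StabGraph V} {a b : V} (hab : b ∈ G.nbr a) (ha : a ∉ G.loops)
    (hb : b ∉ G.loops) : (G.ruleE2 a b).nodeWeight b = G.nodeWeight a := by
  have hne : b ≠ a := (ne_of_mem_nbr hab).symm
  by_cases hma : a ∈ G.minus <;> by_cases hmb : b ∈ G.minus <;>
    simp [nodeWeight, ruleE2_loops, ruleE2_minus, nbr_localCompEdge_left hab,
      nbr_localCompEdge_right hab, Set.mem_symmDiff, G.notMem_nbr_self b, ha, hb, hne, hma, hmb]

open scoped Classical in
lemma nodeWeight_ruleE2_of_ne {G : StabGraph V} {a b u : V} (hab : b ∈ G.nbr a)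
    (ha : a ∉ G.loops) (hb : b ∉ G.loops) (hua : u ≠ a) (hub : u ≠ b) :
    (G.ruleE2 a b).nodeWeight u = G.nodeWeight u *
      ((if u ∈ G.nbr a ∧ u ∈ G.nbr b then -1 else 1) *
        ((if u ∈ G.nbr a then G.nodeWeight b else 1) *
          (if u ∈ G.nbr b then G.nodeWeight a else 1))) := by
  have hminus : u ∈ (G.ruleE2 a b).minus ↔
      Xor (Xor (Xor (u ∈ G.minus) (u ∈ G.nbr a ∧ u ∈ G.nbr b)) (a ∈ G.minus ∧ u ∈ G.nbr b))
        (b ∈ G.minus ∧ u ∈ G.nbr a) := by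
    by_cases hma : a ∈ G.minus <;> by_cases hmb : b ∈ G.minus <;>
      simp [ruleE2_minus, nbr_localCompEdge_left hab, nbr_localCompEdge_right hab,
        Set.mem_symmDiff, hua, hub, hma, hmb, Xor]
  by_cases hna : u ∈ G.nbr a <;> by_cases hnb : u ∈ G.nbr b <;> by_cases hmu : u ∈ G.minus <;>
    by_cases hma : a ∈ G.minus <;> by_cases hmb : b ∈ G.minus <;>
    simp [nodeWeight, hminus, ruleE2_loops, ha, hb, hna, hnb, hmu, hma, hmb]

variable [Fintype V] [DecidableEq V]

lemma hadamardLayer_singleton_mulVec_phase (G : StabGraph V) (v : V) (x : V → Fin 2) :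
    (hadamardLayer {v} *ᵥ G.phase) x = hadamardCoeff *
      (G.phase (Function.update x v 0) *
        (1 + G.nodeWeight v * setSign (insert v (G.nbr v)) x)) := by
  have hupd : Function.update x v 1 = Function.update (Function.update x v 0) v 1 := by simp
  rw [hadamardLayer_singleton_mulVec, hupd, phase_update_one _ (by simp),
    setSign_update_of_notMem (G.notMem_nbr_self v), setSign_insert (G.notMem_nbr_self v)]
  ring

lemma hadamardLayer_mulVec_phase_ruleE1 {G : StabGraph V} {v : V} (hv : v ∈ G.loops) :
    hadamardLayer {v} *ᵥ G.phase =
      (hadamardCoeff * (1 + G.nodeWeight v)) • (G.ruleE1 v).phase := by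
  have hzero : (hadamardLayer {v} *ᵥ G.phase) 0 = hadamardCoeff * (1 + G.nodeWeight v) := by
    have hupd : Function.update (0 : V → Fin 2) v 0 = 0 := by simp
    rw [hadamardLayer_singleton_mulVec_phase, hupd, phase_zero,
      setSign_zero, one_mul, mul_one]
  rw [← hzero]
  refine eq_smul_phase fun u x hu => ?_
  rw [hadamardLayer_singleton_mulVec_phase, hadamardLayer_singleton_mulVec_phase, ruleE1_nbr]
  have hsq : (G.nodeWeight v * setSign (insert v (G.nbr v)) x) ^ 2 = -1 := by
    rw [mul_pow, nodeWeight_sq_of_mem_loops hv, setSign_sq, mul_one]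
  obtain rfl | huv := eq_or_ne u v
  · rw [nodeWeight_ruleE1_self hv, nbr_localComp_self, Function.update_idem,
      setSign_update_one_of_mem (Set.mem_insert _ _) hu, ← setSign_insert_of_eq_zero (G.nbr u) hu]
    linear_combination (hadamardCoeff * G.phase (Function.update x u 0)) * hsq
  rw [Function.update_comm huv, phase_update_one G (by simp [huv, hu]), setSign_update_zero]
  by_cases hn : u ∈ G.nbr v
  · rw [nodeWeight_ruleE1_of_mem hv hn, setSign_update_one_of_mem (Set.mem_insert_of_mem _ hn) hu,
      ← setSign_insert_of_eq_zero ((G.localComp v).nbr u) hu, insert_nbr_localComp_of_mem hn,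
      setSign_symmDiff]
    linear_combination (hadamardCoeff * G.phase (Function.update x v 0) * G.nodeWeight u *
      setSign (G.nbr u \ {v}) x) * hsq
  · have hvu : v ∉ G.nbr u := mt mem_nbr_comm.1 hn
    have hu' : u ∉ insert v (G.nbr v) := by simp [huv, hn]
    rw [nodeWeight_ruleE1_of_notMem hn huv, nbr_localComp_of_notMem hn,
      setSign_update_of_notMem hu', Set.sdiff_singleton_eq_self hvu]
    ring

lemma equivalent_ruleE1 {G : StabGraph V} {v : V} (hv : v ∈ G.loops) :
    G.Equivalent (G.ruleE1 v) :=
  equivalent_of_hadamardLayer_mulVec_phase (G.ruleE1_hollow v)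
    (norm_hadamardCoeff_mul_one_add (nodeWeight_sq_of_mem_loops hv))
    (hadamardLayer_mulVec_phase_ruleE1 hv)

/-- The factor by which Hadamard gates on two adjacent nodes without loops multiply, up to the
constant `1 / 2`, the phase function; `α` and `β` are signs. -/
def pivotSum (α β : ℂ) : ℂ := 1 + α + β - α * β

lemma norm_half_mul_pivotSum {α β : ℂ} (hα : α ^ 2 = 1) (hβ : β ^ 2 = 1) :
    ‖1 / 2 * pivotSum α β‖ = 1 := by
  obtain rfl | rfl := sq_eq_one_iff.1 hα <;>
    obtain rfl | rfl := sq_eq_one_iff.1 hβ <;> norm_num [pivotSum]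

open scoped Classical in
lemma pivotSum_setSign_update_one {α β : ℂ} (hα : α ^ 2 = 1) (hβ : β ^ 2 = 1) (S T : Set V)
    {x : V → Fin 2} {u : V} (hu : x u = 0) :
    pivotSum (α * setSign S (Function.update x u 1)) (β * setSign T (Function.update x u 1)) =
      (if u ∈ S ∧ u ∈ T then -1 else 1) *
        ((if u ∈ S then β * setSign T x else 1) * (if u ∈ T then α * setSign S x else 1)) *
          pivotSum (α * setSign S x) (β * setSign T x) := by
  have hαS : (α * setSign S x) ^ 2 = 1 := by rw [mul_pow, hα, setSign_sq, mul_one]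
  have hβT : (β * setSign T x) ^ 2 = 1 := by rw [mul_pow, hβ, setSign_sq, mul_one]
  have hS : α * setSign S (Function.update x u 1) =
      if u ∈ S then -(α * setSign S x) else α * setSign S x := by
    split_ifs with h
    · rw [setSign_update_one_of_mem h hu, mul_neg]
    · rw [setSign_update_of_notMem h]
  have hT : β * setSign T (Function.update x u 1) =
      if u ∈ T then -(β * setSign T x) else β * setSign T x := by
    split_ifs with h
    · rw [setSign_update_one_of_mem h hu, mul_neg]
    · rw [setSign_update_of_notMem h]
  rw [hS, hT]
  generalize α * setSign S x = A at *
  generalize β * setSign T x = B at *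
  by_cases huS : u ∈ S <;> by_cases huT : u ∈ T <;>
    simp only [huS, huT, and_true, and_false, if_true, if_false, pivotSum]
  · linear_combination (B - 1) * hαS + (A - A ^ 2) * hβT
  · linear_combination (A - 1) * hβT
  · linear_combination (B - 1) * hαS
  · ring

lemma hadamardLayer_pair_mulVec_phase {G : StabGraph V} {a b : V} (hab : b ∈ G.nbr a)
    (x : V → Fin 2) :
    (hadamardLayer {a, b} *ᵥ G.phase) x = 1 / 2 *
      (G.phase (Function.update (Function.update x a 0) b 0) *
        pivotSum (G.nodeWeight a * setSign ((G.localCompEdge a b).nbr b) x)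
          (G.nodeWeight b * setSign ((G.localCompEdge a b).nbr a) x)) := by
  have hne : a ≠ b := ne_of_mem_nbr hab
  have hpair : ({a, b} : Set V) = {a} ∆ {b} := (Set.disjoint_singleton.2 hne).symmDiff_eq_sup.symm
  have hbit : Function.update x a 1 = Function.update (Function.update x a 0) a 1 := by simp
  have hbits : Function.update (Function.update (Function.update x a 0) a 1) b 0 =
      Function.update (Function.update (Function.update x a 0) b 0) a 1 :=
    Function.update_comm hne _ _ _
  have hsign_a : setSign {a} x * setSign (G.nbr a) (Function.update (Function.update x a 0) b 0) =
      setSign ((G.localCompEdge a b).nbr b) x := by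
    have ha : a ∉ G.nbr a \ {b} := fun h => G.notMem_nbr_self a h.1
    rw [setSign_update_zero, setSign_update_of_notMem ha, nbr_localCompEdge_right hab,
      setSign_insert ha]
  have hsign_b : setSign (insert b (G.nbr b)) (Function.update x a 0) =
      setSign ((G.localCompEdge a b).nbr a) x := by
    rw [setSign_update_zero, nbr_localCompEdge_left hab, Set.insert_sdiff_singleton_comm hne.symm]
  have hflip : setSign (insert b (G.nbr b)) (Function.update (Function.update x a 0) a 1) =
      -setSign ((G.localCompEdge a b).nbr a) x := by
    rw [setSign_update_one_of_mem (Set.mem_insert_of_mem _ (mem_nbr_comm.1 hab)) (by simp), hsign_b]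
  rw [hpair, ← hadamardLayer_mul, ← Matrix.mulVec_mulVec, hadamardLayer_singleton_mulVec,
    hadamardLayer_singleton_mulVec_phase, hadamardLayer_singleton_mulVec_phase, hbit, hbits,
    phase_update_one G (by simp [hne]), hsign_b, hflip, ← hsign_a, ← hadamardCoeff_sq, pivotSum]
  ring

lemma hadamardLayer_mulVec_phase_ruleE2 {G : StabGraph V} {a b : V} (hab : b ∈ G.nbr a)
    (ha : a ∉ G.loops) (hb : b ∉ G.loops) :
    hadamardLayer {a, b} *ᵥ G.phase =
      (1 / 2 * pivotSum (G.nodeWeight a) (G.nodeWeight b)) • (G.ruleE2 a b).phase := by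
  classical
  have hne : a ≠ b := ne_of_mem_nbr hab
  have hzero : (hadamardLayer {a, b} *ᵥ G.phase) 0 =
      1 / 2 * pivotSum (G.nodeWeight a) (G.nodeWeight b) := by
    have hupd : Function.update (Function.update (0 : V → Fin 2) a 0) b 0 = 0 := by simp
    rw [hadamardLayer_pair_mulVec_phase hab, hupd, phase_zero, setSign_zero, setSign_zero, one_mul,
      mul_one, mul_one]
  rw [← hzero]
  refine eq_smul_phase fun u x hu => ?_
  rw [hadamardLayer_pair_mulVec_phase hab, hadamardLayer_pair_mulVec_phase hab, ruleE2_nbr,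
    pivotSum_setSign_update_one (nodeWeight_sq_of_notMem_loops ha)
      (nodeWeight_sq_of_notMem_loops hb) _ _ hu]
  obtain rfl | hua := eq_or_ne u a
  · have hmem : u ∈ (G.localCompEdge u b).nbr b := by simp [nbr_localCompEdge_right hab]
    rw [nodeWeight_ruleE2_left hab ha hb, Function.update_idem]
    simp only [hmem, notMem_nbr_self, and_false, if_true, if_false]
    ring
  obtain rfl | hub := eq_or_ne u b
  · have hmem : u ∈ (G.localCompEdge a u).nbr a := by simp [nbr_localCompEdge_left hab]
    rw [nodeWeight_ruleE2_right hab ha hb, Function.update_comm hua, Function.update_idem]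
    simp only [hmem, notMem_nbr_self, false_and, if_true, if_false]
    ring
  have hmem_a : u ∈ (G.localCompEdge a b).nbr b ↔ u ∈ G.nbr a := by
    simp [nbr_localCompEdge_right hab, hua, hub]
  have hmem_b : u ∈ (G.localCompEdge a b).nbr a ↔ u ∈ G.nbr b := by
    simp [nbr_localCompEdge_left hab, hua, hub]
  rw [nodeWeight_ruleE2_of_ne hab ha hb hua hub, nbr_localCompEdge_of_ne hab hua hub,
    Function.update_comm hua, Function.update_comm hub, phase_update_one G (by simp [hua, hub, hu]),
    setSign_update_zero, setSign_update_zero, Set.sdiff_sdiff, Set.union_singleton,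
    setSign_symmDiff (G.nbr u \ {a, b}), setSign_symmDiff (ite _ _ _)]
  by_cases hna : u ∈ G.nbr a <;> by_cases hnb : u ∈ G.nbr b <;>
    simp only [hmem_a, hmem_b, hna, hnb, and_true, and_false, if_true, if_false, setSign_empty] <;>
    ring

lemma equivalent_ruleE2 {G : StabGraph V} {a b : V} (hab : b ∈ G.nbr a) (ha : a ∉ G.loops)
    (hb : b ∉ G.loops) : G.Equivalent (G.ruleE2 a b) :=
  equivalent_of_hadamardLayer_mulVec_phase (G.ruleE2_hollow a b)
    (norm_half_mul_pivotSum (nodeWeight_sq_of_notMem_loops ha) (nodeWeight_sq_of_notMem_loops hb))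
    (hadamardLayer_mulVec_phase_ruleE2 hab ha hb)

lemma Step.equivalent {G G' : StabGraph V} (h : G.Step G') : G.Equivalent G' := by
  cases h with
  | e1 v hv => exact equivalent_ruleE1 hv
  | e2 a b hab ha hb => exact equivalent_ruleE2 hab ha hb

end Soundness

/-! ### Reduced graphs -/

section Reduced

lemma symmDiff_pair_of_mem_of_notMem {A : Set V} {a s : V} (ha : a ∈ A) (hs : s ∉ A) :
    A ∆ {a, s} = insert s (A \ {a}) := by
  ext w
  simp only [Set.mem_symmDiff, Set.mem_insert_iff, Set.mem_singleton_iff, Set.mem_sdiff]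
  grind

lemma ReducedStep.reflTransGen_step {G G' : StabGraph V} (hst : G.ReducedStep G') :
    Relation.ReflTransGen Step G G' := by
  cases hst with
  | ei hG h s hh hs hhs hl =>
    have hloop : h ∈ (G.ruleE1 s).loops := by
      rw [ruleE1_loops]
      exact Or.inr ⟨hhs.symm, hG.1 h hh⟩
    rw [ruleEi_eq_ruleE1_ruleE1 hl (hG.1 h hh) hhs]
    exact .tail (.single (.e1 _ s hl)) (.e1 _ h hloop)
  | eii hG h s hh hs hhs hl => exact .single (.e2 _ h s hhs (hG.1 h hh) hl)

lemma IsReduced.ruleEi {G : StabGraph V} (hG : G.IsReduced) {h s : V} (hh : h ∈ G.hollow)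
    (hs : s ∉ G.hollow) (hhs : s ∈ G.nbr h) : (G.ruleEi h s).IsReduced := by
  obtain ⟨hloops, hedges⟩ := hG
  replace hedges : ∀ a ∈ G.hollow, ∀ b ∈ G.hollow, b ∉ G.nbr a := hedges
  have hhollow : (G.ruleEi h s).hollow = insert s (G.hollow \ {h}) := by
    rw [ruleEi_hollow, symmDiff_pair_of_mem_of_notMem hh hs]
  have hsh : h ∈ G.nbr s := mem_nbr_comm.1 hhs
  constructor
  · intro v hv
    rw [hhollow] at hv
    simp only [ruleEi_loops, Set.mem_symmDiff, Set.mem_sdiff, Set.mem_singleton_iff,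
      mem_nbr_localComp]
    grind [Xor, notMem_nbr_self, mem_nbr_comm]
  · intro a ha b hb
    rw [hhollow] at ha hb
    rw [ruleEi_edges]
    change b ∉ ((G.localComp s).localComp h).nbr a
    simp only [mem_nbr_localComp]
    grind [Xor, notMem_nbr_self, mem_nbr_comm]

lemma IsReduced.ruleEii {G : StabGraph V} (hG : G.IsReduced) {h s : V} (hh : h ∈ G.hollow)
    (hs : s ∉ G.hollow) (hhs : s ∈ G.nbr h) (hl : s ∉ G.loops) : (G.ruleEii h s).IsReduced := by
  obtain ⟨hloops, hedges⟩ := hG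
  replace hedges : ∀ a ∈ G.hollow, ∀ b ∈ G.hollow, b ∉ G.nbr a := hedges
  have hhollow : (G.ruleEii h s).hollow = insert s (G.hollow \ {h}) := by
    rw [ruleEii_eq_ruleE2, ruleE2_hollow, symmDiff_pair_of_mem_of_notMem hh hs]
  have hsh : h ∈ G.nbr s := mem_nbr_comm.1 hhs
  constructor
  · intro v hv
    rw [hhollow] at hv
    rw [ruleEii_eq_ruleE2, ruleE2_loops]
    grind
  · intro a ha b hb
    rw [hhollow] at ha hb
    rw [ruleEii_eq_ruleE2, ruleE2_edges]
    change b ∉ (G.localCompEdge h s).nbr a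
    simp only [localCompEdge, mem_nbr_localComp]
    grind [Xor, notMem_nbr_self, mem_nbr_comm]

lemma ReducedStep.isReduced {G G' : StabGraph V} (hst : G.ReducedStep G') : G'.IsReduced := by
  cases hst with
  | ei hG h s hh hs hhs hl => exact hG.ruleEi hh hs hhs
  | eii hG h s hh hs hhs hl => exact hG.ruleEii hh hs hhs hl

lemma ReducedStep.ncard_hollow {G G' : StabGraph V} (hst : G.ReducedStep G') :
    G'.hollow.ncard = G.hollow.ncard := by
  cases hst with
  | ei hG h s hh hs hhs hl =>
    rw [ruleEi_hollow, symmDiff_pair_of_mem_of_notMem hh hs, Set.ncard_exchange hs hh]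
  | eii hG h s hh hs hhs hl =>
    rw [ruleEii_eq_ruleE2, ruleE2_hollow, symmDiff_pair_of_mem_of_notMem hh hs,
      Set.ncard_exchange hs hh]

lemma IsReduced.exists_reducedStep {G : StabGraph V} (hG : G.IsReduced) {h s : V}
    (hh : h ∈ G.hollow) (hhs : s ∈ G.nbr h) :
    ∃ G', G.ReducedStep G' ∧ G'.hollow = insert s (G.hollow \ {h}) := by
  have hs : s ∉ G.hollow := fun hs => hG.2 h hh s hs hhs
  rw [← symmDiff_pair_of_mem_of_notMem hh hs]
  by_cases hl : s ∈ G.loops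
  · exact ⟨_, .ei G hG h s hh hs hhs hl, G.ruleEi_hollow h s⟩
  · exact ⟨_, .eii G hG h s hh hs hhs hl, G.ruleE2_hollow h s⟩

lemma exists_step_hollow_ssubset {G : StabGraph V} (hG : ¬ G.IsReduced) :
    ∃ G', G.Step G' ∧ G'.hollow ⊂ G.hollow := by
  have hflip {A : Set V} (hA : A ⊆ G.hollow) (hne : A.Nonempty) :
      G.hollow ∆ A ⊂ G.hollow := by
    rw [symmDiff_of_ge hA]
    exact LE.le.sdiff_ssubset_of_nonempty hA hne
  by_cases hloop : ∃ v ∈ G.hollow, v ∈ G.loops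
  · obtain ⟨v, hv, hl⟩ := hloop
    refine ⟨_, .e1 G v hl, ?_⟩
    rw [ruleE1_hollow]
    exact hflip (Set.singleton_subset_iff.2 hv) (Set.singleton_nonempty v)
  · push Not at hloop
    obtain ⟨a, ha, b, hb, hab⟩ : ∃ a ∈ G.hollow, ∃ b ∈ G.hollow, G.edges.Adj a b := by
      by_contra! hadj
      exact hG ⟨hloop, hadj⟩
    refine ⟨_, .e2 G a b hab (hloop a ha) (hloop b hb), ?_⟩
    rw [ruleE2_hollow]
    exact hflip (Set.pair_subset ha hb) (Set.insert_nonempty a {b})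

lemma exists_isReduced_hollow_subset [Finite V] (G : StabGraph V) :
    ∃ R : StabGraph V, R.IsReduced ∧ Relation.ReflTransGen Step G R ∧ R.hollow ⊆ G.hollow := by
  induction hA : G.hollow using WellFoundedLT.induction generalizing G with
  | ind A ih =>
    subst hA
    by_cases hG : G.IsReduced
    · exact ⟨G, hG, .refl, subset_rfl⟩
    · obtain ⟨G', hst, hlt⟩ := exists_step_hollow_ssubset hG
      obtain ⟨R, hR, hGR, hsub⟩ := ih G'.hollow hlt G' rfl
      exact ⟨R, hR, .head hst hGR, hsub.trans hlt.subset⟩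

lemma reflTransGen_step_of_reducedStep {G G' : StabGraph V}
    (h : Relation.ReflTransGen ReducedStep G G') : Relation.ReflTransGen Step G G' := by
  induction h with
  | refl => exact .refl
  | tail _ hst ih => exact ih.trans hst.reflTransGen_step

lemma ncard_hollow_eq_of_reflTransGen_reducedStep {G G' : StabGraph V}
    (h : Relation.ReflTransGen ReducedStep G G') : G'.hollow.ncard = G.hollow.ncard := by
  induction h with
  | refl => rfl
  | tail _ hst ih => rw [hst.ncard_hollow, ih]

end Reduced

/-! ### Completeness of the rules -/

section Completeness

-- A rule applied twice preserves both the state and the hollow nodes, hence the graph.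
lemma Step.symm [Finite V] {G G' : StabGraph V} (hst : G.Step G') : G'.Step G := by
  classical
  have := Fintype.ofFinite V
  cases hst with
  | e1 v hv =>
    have hv' : v ∈ (G.ruleE1 v).loops := by
      rw [ruleE1_loops]
      exact Or.inl ⟨hv, G.notMem_nbr_self v⟩
    have hst' := Step.e1 _ v hv'
    have hG : G = (G.ruleE1 v).ruleE1 v := by
      refine ((Step.e1 G v hv).equivalent.trans hst'.equivalent).eq_of_hollow_eq ?_
      rw [ruleE1_hollow, ruleE1_hollow, symmDiff_symmDiff_cancel_right]
    rwa [← hG] at hst'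
  | e2 a b hab ha hb =>
    have hab' : (G.ruleE2 a b).edges.Adj a b := by
      change b ∈ (G.ruleE2 a b).nbr a
      rw [ruleE2_nbr, nbr_localCompEdge_left hab]
      exact Set.mem_insert b _
    have hst' := Step.e2 _ a b hab' (by rwa [ruleE2_loops]) (by rwa [ruleE2_loops])
    have hG : G = (G.ruleE2 a b).ruleE2 a b := by
      refine ((Step.e2 G a b hab ha hb).equivalent.trans hst'.equivalent).eq_of_hollow_eq ?_
      rw [ruleE2_hollow, ruleE2_hollow, symmDiff_symmDiff_cancel_right]
    rwa [← hG] at hst'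

variable [Fintype V] [DecidableEq V]

lemma equivalent_of_reflTransGen_step {G G' : StabGraph V}
    (h : Relation.ReflTransGen Step G G') : G.Equivalent G' := by
  induction h with
  | refl => exact Equivalent.refl G
  | tail _ hst ih => exact ih.trans hst.equivalent

lemma ReducedStep.equivalent {G G' : StabGraph V} (hst : G.ReducedStep G') : G.Equivalent G' :=
  equivalent_of_reflTransGen_step hst.reflTransGen_step

lemma IsReduced.nodeWeight_mul_setSign_eq_one {G : StabGraph V} (hG : G.IsReduced) {h : V}
    (hh : h ∈ G.hollow) {x : V → Fin 2} (hx : G.state x ≠ 0) :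
    G.nodeWeight h * setSign (insert h (G.nbr h)) x = 1 := by
  have hhollow : G.hollow = (G.hollow \ {h}) ∆ {h} := by
    rw [Set.disjoint_sdiff_left.symmDiff_eq_sup]
    exact (Set.sdiff_union_of_subset (Set.singleton_subset_iff.2 hh)).symm
  have hx' : (hadamardLayer (G.hollow \ {h}) *ᵥ (hadamardLayer {h} *ᵥ G.phase)) x ≠ 0 := by
    rw [Matrix.mulVec_mulVec, hadamardLayer_mul, ← hhollow]
    rw [state_eq] at hx
    exact right_ne_zero_of_mul hx
  obtain ⟨y, hyx, hy⟩ := exists_ne_zero_of_hadamardLayer_mulVec_ne_zero hx'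
  have hsign : setSign (insert h (G.nbr h)) y = setSign (insert h (G.nbr h)) x := by
    refine setSign_congr_right fun w hw => hyx w fun hwG => ?_
    exact hG.2 h hh w hwG.1 (Set.mem_of_mem_insert_of_ne hw hwG.2)
  rw [hadamardLayer_singleton_mulVec_phase, hsign] at hy
  have hsq : (G.nodeWeight h * setSign (insert h (G.nbr h)) x) ^ 2 = 1 := by
    rw [mul_pow, nodeWeight_sq_of_notMem_loops (hG.1 h hh), setSign_sq, mul_one]
  refine (sq_eq_one_iff.1 hsq).resolve_right fun hneg => ?_
  simp [hneg] at hy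

lemma IsReduced.exists_mem_nbr_of_mem_of_notMem {G G' : StabGraph V} (hG : G.IsReduced)
    (h : G.Equivalent G') {a : V} (ha : a ∈ G.hollow) (ha' : a ∉ G'.hollow) :
    ∃ s ∈ G.nbr a, s ∈ G'.hollow := by
  -- The linear constraint imposed by `a` would hold at two points of the support of the state
  -- which, among the nodes involved, differ only in the bit `a`.
  by_contra! hsolid
  have hconstraint {x : V → Fin 2} (hx : G'.state x ≠ 0) :
      G.nodeWeight a * setSign (insert a (G.nbr a)) x = 1 := by
    obtain ⟨c, -, hc⟩ := h
    rw [hc] at hx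
    exact hG.nodeWeight_mul_setSign_eq_one ha (right_ne_zero_of_mul hx)
  have hsolid' : ∀ w ∈ insert a (G.nbr a), w ∉ G'.hollow := Set.forall_mem_insert.2 ⟨ha', hsolid⟩
  have hweight : G.nodeWeight a = 1 := by
    obtain ⟨x, hxz, hx⟩ := G'.exists_state_ne_zero 0
    have := hconstraint hx
    rwa [setSign_congr_right fun w hw => hxz w (hsolid' w hw), setSign_zero, mul_one] at this
  obtain ⟨y, hyz, hy⟩ := G'.exists_state_ne_zero (Function.update 0 a 1)
  have hfalse := hconstraint hy
  rw [setSign_congr_right fun w hw => hyz w (hsolid' w hw),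
    setSign_update_one_of_mem (x := 0) (Set.mem_insert a _) rfl, setSign_zero, hweight] at hfalse
  norm_num at hfalse

lemma IsReduced.reflTransGen_reducedStep {G G' : StabGraph V} (hG : G.IsReduced)
    (hG' : G'.IsReduced) (h : G.Equivalent G') : Relation.ReflTransGen ReducedStep G G' := by
  induction hn : (G.hollow \ G'.hollow).ncard generalizing G with
  | zero =>
    have hsub : G.hollow ⊆ G'.hollow := by
      rwa [Set.ncard_eq_zero (Set.toFinite _), Set.sdiff_eq_empty] at hn
    have hsub' : G'.hollow ⊆ G.hollow := by
      intro a ha'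
      by_contra ha
      obtain ⟨s, has, hs⟩ := hG'.exists_mem_nbr_of_mem_of_notMem h.symm ha' ha
      exact hG'.2 a ha' s (hsub hs) has
    rw [h.eq_of_hollow_eq (hsub.antisymm hsub')]
  | succ n ih =>
    obtain ⟨a, ha⟩ : (G.hollow \ G'.hollow).Nonempty :=
      Set.nonempty_of_ncard_ne_zero (by omega)
    obtain ⟨s, has, hs⟩ := hG.exists_mem_nbr_of_mem_of_notMem h ha.1 ha.2
    obtain ⟨G₁, hst, hhollow⟩ := hG.exists_reducedStep ha.1 has
    refine .head hst (ih hst.isReduced (hst.equivalent.symm.trans h) ?_)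
    rw [hhollow, Set.insert_sdiff_of_mem _ hs, sdiff_right_comm,
      Set.ncard_sdiff_singleton_of_mem ha, hn, Nat.add_sub_cancel]

lemma Equivalent.reflTransGen_step {G G' : StabGraph V} (h : G.Equivalent G') :
    Relation.ReflTransGen Step G G' := by
  obtain ⟨R, hR, hGR, -⟩ := exists_isReduced_hollow_subset G
  obtain ⟨R', hR', hGR', -⟩ := exists_isReduced_hollow_subset G'
  have hRR' : R.Equivalent R' := (equivalent_of_reflTransGen_step hGR).symm.trans
    (h.trans (equivalent_of_reflTransGen_step hGR'))
  have : Std.Symm (Step (V := V)) := ⟨fun _ _ => Step.symm⟩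
  calc
    Relation.ReflTransGen Step G R := hGR
    Relation.ReflTransGen Step R R' :=
      reflTransGen_step_of_reducedStep (hR.reflTransGen_reducedStep hR' hRR')
    Relation.ReflTransGen Step R' G' := _root_.symm hGR'

lemma isReduced_iff_forall_ncard_hollow_le (G : StabGraph V) : G.IsReduced ↔
    ∀ G' : StabGraph V, G.Equivalent G' → G.hollow.ncard ≤ G'.hollow.ncard := by
  constructor
  · intro hG G' h
    obtain ⟨R, hR, hGR, hsub⟩ := exists_isReduced_hollow_subset G'
    have hred := hG.reflTransGen_reducedStep hR (h.trans (equivalent_of_reflTransGen_step hGR))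
    rw [← ncard_hollow_eq_of_reflTransGen_reducedStep hred]
    exact Set.ncard_le_ncard hsub
  · intro hmin
    by_contra hG
    obtain ⟨G', hst, hlt⟩ := exists_step_hollow_ssubset hG
    exact (Set.ncard_lt_ncard hlt).not_ge (hmin G' hst.equivalent)

end Completeness

end StabGraph

theorem mainTheorem1 {V : Type*} [Fintype V] [DecidableEq V] :
    -- E1 and E2 preserve the represented state
    (∀ G G' : StabGraph V, G.Step G' → G.Equivalent G') ∧
    -- E(i) and E(ii) take reduced graphs to equivalent reduced graphs
    (∀ G G' : StabGraph V, G.ReducedStep G' → G'.IsReduced ∧ G.Equivalent G') ∧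
    -- graphs represent the same state iff finitely many uses of E1, E2 convert one to the other
    (∀ G G' : StabGraph V,
      G.Equivalent G' ↔ Relation.ReflTransGen StabGraph.Step G G') ∧
    -- the same for reduced graphs with E(i), E(ii)
    (∀ G G' : StabGraph V, G.IsReduced → G'.IsReduced →
      (G.Equivalent G' ↔ Relation.ReflTransGen StabGraph.ReducedStep G G')) ∧
    -- the reduced graphs of a state are its graphs with the fewest hollow nodes
    (∀ G : StabGraph V,
      G.IsReduced ↔ ∀ G' : StabGraph V, G.Equivalent G' → G.hollow.ncard ≤ G'.hollow.ncard) := by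
  refine ⟨fun G G' h => h.equivalent, fun G G' h => ⟨h.isReduced, h.equivalent⟩,
    fun G G' => ⟨fun h => h.reflTransGen_step, StabGraph.equivalent_of_reflTransGen_step⟩,
    fun G G' hG hG' => ⟨hG.reflTransGen_reducedStep hG', fun h =>
      StabGraph.equivalent_of_reflTransGen_step (StabGraph.reflTransGen_step_of_reducedStep h)⟩,
    StabGraph.isReduced_iff_forall_ncard_hollow_le⟩
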